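/- Let $\{0\to1\}$ be the poset with two elements $0<1$, and let $B=\{0\to1\}^3$ (with the componentwise order), $A=B\setminus\{111\}$ and $C=A\setminus\{000\}$ (with the induced orders). Regard these posets as small categories and their inclusions as functors, and form the pushouts $D=A\sqcup_C A$ (of the inclusion $C\to A$ along itself) and $E=D\sqcup_A B$ (of one of the two canonical functors $A\to D$ along the inclusion $A\to B$) in the category $\mathbf{Cat}$ of small categories. Then the canonical functor $D\to E$ is not a Thomason weak equivalence. Here a functor $F$ between small categories is a Thomason weak equivalence if $\mathrm{Ex}^2\mathbf{N}(F)$ is a weak equivalence in the Kan–Quillen model structure on simplicial sets, where $\mathbf{N}$ is the nerve functor and $\mathrm{Ex}$ is Kan's extension functor, the right adjoint of the subdivision functor $\mathrm{Sd}$. -/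

import Mathlib

open CategoryTheory

universe u

/-- The weak equivalences of the Kan-Quillen model structure on simplicial sets, as they are
determined by its cofibrations (the monomorphisms) and its fibrations (the Kan fibrations, i.e. the
maps with the right lifting property against all horn inclusions): `f` is a weak equivalence iff
`f = i ≫ p` where `i` has the left lifting property against all Kan fibrations
(`i` is an acyclic cofibration, alias anodyne extension) and `p` has the right lifting property
against all monomorphisms (`p` is an acyclic fibration). -/
def kanQuillenWeakEquivalences : MorphismProperty SSet.{u} := fun X Y f =>
  ∃ (Z : SSet.{u}) (i : X ⟶ Z) (p : Z ⟶ Y),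
    SSet.anodyneExtensions i ∧ (MorphismProperty.monomorphisms SSet.{u}).rlp p ∧ i ≫ p = f

/-- The functor `Ex² N` from small categories to simplicial sets: the nerve, followed by two
applications of Kan's extension functor `Ex`, the right adjoint of the subdivision `Sd`. -/
noncomputable def exSqNerve : Cat.{u, u} ⥤ SSet.{u} :=
  nerveFunctor ⋙ SSet.ex ⋙ SSet.ex

/-- Thomason weak equivalences: the functors that `Ex² N` sends to Kan-Quillen weak
equivalences. -/
def thomasonWeakEquivalences : MorphismProperty Cat.{u, u} :=
  kanQuillenWeakEquivalences.inverseImage exSqNerve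

/-- The poset `B = {0 → 1}³`, with the componentwise order. -/
abbrev CubeB : Type := Fin 3 → Fin 2

/-- The poset `A = B ∖ {111}`, with the induced order. -/
abbrev CubeA : Type := {b : CubeB // b ≠ fun _ => 1}

/-- The poset `C = A ∖ {000}`, with the induced order. -/
abbrev CubeC : Type := {a : CubeA // a.1 ≠ fun _ => 0}

/-- A partially ordered set regarded as a small category: there is a unique morphism `x ⟶ y` if
`x ≤ y`, and none otherwise. -/
abbrev posetCat (P : Type) [PartialOrder P] : Cat.{0, 0} := preordToCat.obj (Preord.of P)

/-- The inclusion `A ⊂ B`, as a functor. -/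
def inclAB : posetCat CubeA ⟶ posetCat CubeB :=
  preordToCat.map (Preord.ofHom (OrderHom.Subtype.val fun b : CubeB => b ≠ fun _ => 1))

/-- The inclusion `C ⊂ A`, as a functor. -/
def inclCA : posetCat CubeC ⟶ posetCat CubeA :=
  preordToCat.map (Preord.ofHom (OrderHom.Subtype.val fun a : CubeA => a.1 ≠ fun _ => 0))

/-! Geometrically, `D` is a 2-sphere: two cones over the hexagon `C`, with apexes the two copies of
`000`. The pushout `E` is formed in categories, so attaching the cube has an effect on both cones.
Composites of arrows through `C` with arrows to `111` give arrows from the second copy of `000` to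
`111`, all equal because the hexagon is connected. Hence the image of `111` is the vertex of a
cocone on all of `d` (`exists_cocone_of_cube`), and `d` factors through the cone `WithTerminal D`.

If `d` were a weak equivalence, every mod 2 cocycle on the nerve of `D` would then extend to the
cone (`exists_twoCocycle_extension`) and so be a coboundary (`exists_cobounding`). But the
fundamental cocycle of the sphere, pulled back from the octahedron (`exists_twoCocycle_pushout`),
sums to 1 over the sphere, while a coboundary sums to 0.

The passage through `Ex²` needs no comparison of `X` with `Ex X`. The Kan complex `twoCocycles` has
a map `exTwoCocycles` back from its `Ex`, given by subdivision of cochains. With the last vertex map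
`toEx`, it carries a cocycle to `Ex²` and back without changing its values on 2-simplices. -/

open Simplicial Opposite

/-! ### Cocycles and a Kan model of K(ℤ/2, 2) -/

/-- Normalized 2-cocycles with values in `ℤ/2` on the codiscrete simplicial set on `X`. -/
structure IsTwoCocycle {X : Type*} (φ : X → X → X → ZMod 2) : Prop where
  coboundary (a b c d : X) : φ b c d + φ a c d + φ a b d + φ a b c = 0
  diag (a : X) : φ a a a = 0

namespace IsTwoCocycle

variable {X Y : Type*} {φ : X → X → X → ZMod 2}

lemma comp (h : IsTwoCocycle φ) (f : Y → X) :
    IsTwoCocycle fun a b c => φ (f a) (f b) (f c) :=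
  ⟨fun _ _ _ _ => h.coboundary _ _ _ _, fun _ => h.diag _⟩

lemma left_eq_zero (h : IsTwoCocycle φ) (a b : X) : φ a a b = 0 := by
  have h1 := h.coboundary a a a b
  have h2 := h.diag a
  grind

lemma right_eq_zero (h : IsTwoCocycle φ) (a b : X) : φ a b b = 0 := by
  have h1 := h.coboundary a b b b
  have h2 := h.diag b
  grind

lemma of_coboundary (ψ : X → X → ZMod 2) (h : ∀ a, ψ a a = 0) :
    IsTwoCocycle fun a b c => ψ b c + ψ a c + ψ a b :=
  ⟨fun a b c d => by grind, fun a => by simp [h]⟩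

end IsTwoCocycle

/-- The simplicial set whose `n`-simplices are the normalized 2-cocycles on the codiscrete
simplicial set on `{0, …, n}`: a model of the Eilenberg-MacLane space `K(ℤ/2, 2)`. -/
def twoCocycles : SSet.{0} where
  obj n := {φ : Fin (n.unop.len + 1) → Fin (n.unop.len + 1) → Fin (n.unop.len + 1) → ZMod 2 //
    IsTwoCocycle φ}
  map θ := ↾fun φ => ⟨_, φ.2.comp θ.unop.toOrderHom⟩
  map_id _ := rfl
  map_comp _ _ := rfl

lemma twoCocycles_δ_coe {n : ℕ} (j : Fin (n + 2)) (φ : twoCocycles _⦋n + 1⦌) (a b c : Fin (n + 1)) :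
    (twoCocycles.δ j φ).1 a b c = φ.1 (j.succAbove a) (j.succAbove b) (j.succAbove c) :=
  rfl

/-- A compatible family of cocycles on the faces `j ≠ i` of a simplex is the restriction of a
cocycle on the simplex. -/
lemma exists_twoCocycle_of_horn {V J : Type*} (k : V) (S : J → Set V) (hk : ∀ j, k ∈ S j)
    (F : J → V → V → V → ZMod 2) (hF : ∀ j, IsTwoCocycle (F j))
    (compat : ∀ j l a b c, a ∈ S j → b ∈ S j → c ∈ S j → a ∈ S l → b ∈ S l → c ∈ S l →
      F j a b c = F l a b c) :
    ∃ φ : V → V → V → ZMod 2, IsTwoCocycle φ ∧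
      ∀ j a b c, a ∈ S j → b ∈ S j → c ∈ S j → φ a b c = F j a b c := by
  classical
  -- Contracting onto `k`, which lies on every face, makes each `F j` the coboundary of `F j k`.
  -- These 1-cochains glue, and they extend by 0 to pairs lying on no common face.
  let ψ : V → V → ZMod 2 := fun a b =>
    if h : ∃ j, a ∈ S j ∧ b ∈ S j then F h.choose k a b else 0
  have hψ (j a b) (ha : a ∈ S j) (hb : b ∈ S j) : ψ a b = F j k a b := by
    have h : ∃ j, a ∈ S j ∧ b ∈ S j := ⟨j, ha, hb⟩
    simp only [ψ, dif_pos h]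
    exact compat _ _ _ _ _ (hk _) h.choose_spec.1 h.choose_spec.2 (hk _) ha hb
  refine ⟨fun a b c => ψ b c + ψ a c + ψ a b, .of_coboundary ψ fun a => ?_, fun j a b c ha hb hc => ?_⟩
  · by_cases h : ∃ j, a ∈ S j
    · obtain ⟨j, h⟩ := h
      rw [hψ j a a h h, (hF j).right_eq_zero]
    · exact dif_neg fun ⟨j, hj⟩ => h ⟨j, hj.1⟩
  · have := (hF j).coboundary k a b c
    beta_reduce
    rw [hψ j a b ha hb, hψ j a c ha hc, hψ j b c hb hc]
    grind

lemma kanComplex_twoCocycles : SSet.KanComplex twoCocycles := by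
  rw [SSet.KanComplex.iff]
  intro n i f hf
  -- A retraction of the `j`-th coface; its value at `j` itself plays no role.
  let r (j : Fin (n + 2)) : Fin (n + 2) → Fin (n + 1) := Function.invFun j.succAbove
  have hr (j x) : r j (j.succAbove x) = x :=
    Function.leftInverse_invFun Fin.succAbove_right_injective x
  let G (j : {j // j ≠ i}) := SSet.yonedaEquiv (f j.1 j.2)
  have hG : ∀ (j l : {j // j ≠ i}) (a b c), j.1 < l.1 → a ≠ j.1 → b ≠ j.1 → c ≠ j.1 → a ≠ l.1 →
      b ≠ l.1 → c ≠ l.1 → (G j).1 (r j.1 a) (r j.1 b) (r j.1 c) =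
        (G l).1 (r l.1 a) (r l.1 b) (r l.1 c) := by
    rintro ⟨j, hj⟩ ⟨l, hl⟩ a b c hjl haj hbj hcj hal hbl hcl
    dsimp only at *
    obtain _ | n := n
    · exact absurd hjl (by omega)
    · have key := congrArg SSet.yonedaEquiv (hf j l hj hl hjl)
      rw [SSet.stdSimplex.yonedaEquiv_δ_comp, SSet.stdSimplex.yonedaEquiv_δ_comp] at key
      -- A vertex off both `j` and `l` lies on the common face, which is reached by either double
      -- coface.
      have h (x : Fin (n + 3)) (hxj : x ≠ j) (hxl : x ≠ l) : ∃ y : Fin (n + 1),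
          x = j.succAbove ((l.pred (Fin.ne_zero_of_lt hjl)).succAbove y) ∧
          x = l.succAbove ((j.castPred (Fin.ne_last_of_lt hjl)).succAbove y) := by
        have swap (y : Fin (n + 1)) :
            j.succAbove ((l.pred (Fin.ne_zero_of_lt hjl)).succAbove y) =
              l.succAbove ((j.castPred (Fin.ne_last_of_lt hjl)).succAbove y) := by
          ext
          simp only [Fin.succAbove, Fin.lt_def, Fin.val_castSucc, Fin.coe_castPred, Fin.val_pred]
          have : j.1 < l.1 := hjl
          split_ifs <;> simp_all <;> omega
        obtain ⟨z, rfl⟩ := Fin.exists_succAbove_eq hxl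
        obtain ⟨y, rfl⟩ := Fin.exists_succAbove_eq (x := z)
            (y := j.castPred (Fin.ne_last_of_lt hjl)) fun hz => hxj <| by
          subst hz
          rw [Fin.succAbove_of_castSucc_lt _ _ (by simpa using hjl), Fin.castSucc_castPred]
        exact ⟨y, (swap y).symm, rfl⟩
      obtain ⟨a, ha, ha'⟩ := h a haj hal
      obtain ⟨b, hb, hb'⟩ := h b hbj hbl
      obtain ⟨c, hc, hc'⟩ := h c hcj hcl
      have := congrFun (congrFun (congrFun (congrArg Subtype.val key) a) b) c
      rw [twoCocycles_δ_coe, twoCocycles_δ_coe] at this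
      conv_lhs => rw [ha, hb, hc]
      conv_rhs => rw [ha', hb', hc']
      simpa only [hr] using this
  obtain ⟨φ, hφ, hφ'⟩ := exists_twoCocycle_of_horn i (fun j : {j // j ≠ i} => {j.1}ᶜ)
    (fun j => j.2.symm) (fun j a b c => (G j).1 (r j.1 a) (r j.1 b) (r j.1 c))
    (fun j => (G j).2.comp _) (fun j l a b c haj hbj hcj hal hbl hcl => by
      rcases lt_trichotomy j.1 l.1 with h | h | h
      · exact hG j l a b c h haj hbj hcj hal hbl hcl
      · obtain rfl := Subtype.ext h
        rfl
      · exact (hG l j a b c h hal hbl hcl haj hbj hcj).symm)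
  obtain ⟨g, hg⟩ := (SSet.yonedaEquiv (X := twoCocycles) (n := ⦋n + 1⦌)).surjective ⟨φ, hφ⟩
  refine ⟨g, fun j hj => ?_⟩
  apply SSet.yonedaEquiv.injective
  rw [SSet.stdSimplex.yonedaEquiv_δ_comp, hg]
  refine Subtype.ext (funext fun a => funext fun b => funext fun c => ?_)
  refine (hφ' ⟨j, hj⟩ _ _ _ (Fin.succAbove_ne _ _) (Fin.succAbove_ne _ _)
    (Fin.succAbove_ne _ _)).trans ?_
  simp only [hr, G]

open SSet.modelCategoryQuillen in
/-- Maps to a Kan complex extend along anodyne extensions. -/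
lemma SSet.anodyneExtensions.exists_extension {X Y K : SSet.{u}} [SSet.KanComplex K] {i : X ⟶ Y}
    (hi : SSet.anodyneExtensions i) (f : X ⟶ K) : ∃ g : Y ⟶ K, i ≫ g = f := by
  have h := hi (Limits.terminal.from K) ((HomotopicalAlgebra.isFibrant_iff K).1 inferInstance).mem
  have sq : CommSq f i (Limits.terminal.from K) (Limits.terminal.from Y) := ⟨by simp⟩
  exact ⟨sq.lift, sq.fac_left⟩

/-! ### Cocycles on nerves -/

section Nerve

variable {C : Type} [Category.{0} C] {w x y z : C}

lemma CategoryTheory.ComposableArrows.eq_mk₂ (X : ComposableArrows C 2)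
    (f : X.obj 0 ⟶ X.obj 1) (g : X.obj 1 ⟶ X.obj 2) (hf : X.map' 0 1 = f) (hg : X.map' 1 2 = g) :
    X = ComposableArrows.mk₂ f g :=
  ComposableArrows.ext₂ rfl rfl rfl
    (hf.trans ((Category.id_comp _).trans (Category.comp_id _)).symm)
    (hg.trans ((Category.id_comp _).trans (Category.comp_id _)).symm)

lemma CategoryTheory.nerve.δ₀_mk₃_eq (f : w ⟶ x) (g : x ⟶ y) (h : y ⟶ z) :
    (nerve C).δ 0 (ComposableArrows.mk₃ f g h) = ComposableArrows.mk₂ g h :=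
  ComposableArrows.eq_mk₂ _ _ _ rfl rfl

lemma CategoryTheory.nerve.δ₁_mk₃_eq (f : w ⟶ x) (g : x ⟶ y) (h : y ⟶ z) :
    (nerve C).δ 1 (ComposableArrows.mk₃ f g h) = ComposableArrows.mk₂ (f ≫ g) h :=
  ComposableArrows.eq_mk₂ _ _ _ rfl rfl

lemma CategoryTheory.nerve.δ₂_mk₃_eq (f : w ⟶ x) (g : x ⟶ y) (h : y ⟶ z) :
    (nerve C).δ 2 (ComposableArrows.mk₃ f g h) = ComposableArrows.mk₂ f (g ≫ h) :=
  ComposableArrows.eq_mk₂ _ _ _ rfl rfl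

lemma CategoryTheory.nerve.δ₃_mk₃_eq (f : w ⟶ x) (g : x ⟶ y) (h : y ⟶ z) :
    (nerve C).δ 3 (ComposableArrows.mk₃ f g h) = ComposableArrows.mk₂ f g :=
  ComposableArrows.eq_mk₂ _ _ _ rfl rfl

/-- The value on a pair of composable arrows of the 2-cocycle on the nerve of a category
classified by `σ`. -/
def twoCocycleValue (σ : nerve C ⟶ twoCocycles) (f : w ⟶ x) (g : x ⟶ y) : ZMod 2 :=
  (σ.app (op ⦋2⦌) (ComposableArrows.mk₂ f g)).1 (0 : Fin 3) (1 : Fin 3) (2 : Fin 3)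

lemma twoCocycleValue_coboundary (σ : nerve C ⟶ twoCocycles) (f : w ⟶ x) (g : x ⟶ y)
    (h : y ⟶ z) :
    twoCocycleValue σ g h + twoCocycleValue σ (f ≫ g) h + twoCocycleValue σ f (g ≫ h) +
      twoCocycleValue σ f g = 0 := by
  have key (j : Fin 4) : σ.app (op ⦋2⦌) ((nerve C).δ j (ComposableArrows.mk₃ f g h)) =
      twoCocycles.δ j (σ.app (op ⦋3⦌) (ComposableArrows.mk₃ f g h)) :=
    σ.naturality_apply _ _
  have h0 := key 0
  have h1 := key 1
  have h2 := key 2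
  have h3 := key 3
  rw [nerve.δ₀_mk₃_eq] at h0
  rw [nerve.δ₁_mk₃_eq] at h1
  rw [nerve.δ₂_mk₃_eq] at h2
  rw [nerve.δ₃_mk₃_eq] at h3
  simp only [twoCocycleValue, h0, h1, h2, h3]
  exact (σ.app (op ⦋3⦌) (ComposableArrows.mk₃ f g h)).2.coboundary (0 : Fin 4) (1 : Fin 4)
    (2 : Fin 4) (3 : Fin 4)

lemma nerveMap_mk₂ {D : Type} [Category.{0} D] (F : C ⥤ D) (f : w ⟶ x) (g : x ⟶ y) :
    (nerveMap F).app (op ⦋2⦌) (ComposableArrows.mk₂ f g) =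
      ComposableArrows.mk₂ (F.map f) (F.map g) :=
  ComposableArrows.eq_mk₂ _ _ _ rfl rfl

lemma twoCocycleValue_nerveMap_comp {D : Type} [Category.{0} D] (F : C ⥤ D)
    (σ : nerve D ⟶ twoCocycles) (f : w ⟶ x) (g : x ⟶ y) :
    twoCocycleValue (nerveMap F ≫ σ) f g = twoCocycleValue σ (F.map f) (F.map g) := by
  rw [twoCocycleValue, twoCocycleValue, ← nerveMap_mk₂]
  rfl

end Nerve

/-! ### The subdivision operator on cochains -/

section Subdivision

open PartialOrder Classical

variable {L L' : Type} [PartialOrder L] [PartialOrder L']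

/-- A nonempty finite subset of a totally ordered set, as a nonempty finite chain. -/
def finChain (ht : ∀ a b : L, a ≤ b ∨ b ≤ a) (s : Finset L) (hs : s.Nonempty) :
    NonemptyFiniteChains L :=
  ⟨s, hs, fun _ _ => ht _ _⟩

variable (ht : ∀ a b : L, a ≤ b ∨ b ≤ a) (ht' : ∀ a b : L', a ≤ b ∨ b ≤ a)

/-- The value of a 2-cocycle on the barycentric subdivision of a simplex on the flag
`{p} ⊆ {p, q} ⊆ {p, q, r}`. -/
noncomputable def flagValue (σ : nerve (NonemptyFiniteChains L) ⟶ twoCocycles) (p q r : L) :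
    ZMod 2 :=
  twoCocycleValue σ
    (w := finChain ht {p} (by simp)) (x := finChain ht {p, q} (by simp))
    (y := finChain ht {p, q, r} (by simp))
    (homOfLE (show ({p} : Finset L) ⊆ {p, q} by grind))
    (homOfLE (show ({p, q} : Finset L) ⊆ {p, q, r} by grind))

/-- The subdivision operator on 2-cochains, modulo 2. -/
noncomputable def flagSum (σ : nerve (NonemptyFiniteChains L) ⟶ twoCocycles) (a b c : L) :
    ZMod 2 :=
  flagValue ht σ a b c + flagValue ht σ a c b + flagValue ht σ b a c + flagValue ht σ b c a +
    flagValue ht σ c a b + flagValue ht σ c b a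

lemma twoCocycleValue_congr {Q : Type} [PartialOrder Q] (σ : nerve Q ⟶ twoCocycles)
    {x y z x' y' z' : Q} (f : x ⟶ y) (g : y ⟶ z) (f' : x' ⟶ y') (g' : y' ⟶ z')
    (hx : x = x') (hy : y = y') (hz : z = z') :
    twoCocycleValue σ f g = twoCocycleValue σ f' g' := by
  subst hx hy hz
  rw [Subsingleton.elim f f', Subsingleton.elim g g']

/-- The coboundary of a 2-cocycle on the 3-dimensional flag attached to `p, q, r, s`; the three
terms other than the first are symmetric under a transposition. -/
lemma exists_flagValue_coboundary (σ : nerve (NonemptyFiniteChains L) ⟶ twoCocycles) :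
    ∃ u v w : L → L → L → L → ZMod 2,
      (∀ p q r s, flagValue ht σ p q r + u p q r s + v p q r s + w p q r s = 0) ∧
      (∀ p q r s, u p q r s = u q p r s) ∧ (∀ p q r s, v p q r s = v p r q s) ∧
      (∀ p q r s, w p q r s = w p q s r) := by
  let c₁ (p : L) := finChain ht {p} (by simp)
  let c₂ (p q : L) := finChain ht {p, q} (by simp)
  let c₃ (p q r : L) := finChain ht {p, q, r} (by simp)
  let c₄ (p q r s : L) := finChain ht {p, q, r, s} (by simp)
  let f (p q) : c₁ p ⟶ c₂ p q := homOfLE (show ({p} : Finset L) ⊆ {p, q} by grind)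
  let g (p q r) : c₂ p q ⟶ c₃ p q r :=
    homOfLE (show ({p, q} : Finset L) ⊆ {p, q, r} by grind)
  let h (p q r s) : c₃ p q r ⟶ c₄ p q r s :=
    homOfLE (show ({p, q, r} : Finset L) ⊆ {p, q, r, s} by grind)
  have h₂ (p q) : c₂ p q = c₂ q p :=
    NonemptyFiniteChains.ext (show ({p, q} : Finset L) = {q, p} by grind)
  have h₃ (p q r) : c₃ p q r = c₃ q p r :=
    NonemptyFiniteChains.ext (show ({p, q, r} : Finset L) = {q, p, r} by grind)
  have h₃' (p q r) : c₃ p q r = c₃ p r q :=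
    NonemptyFiniteChains.ext (show ({p, q, r} : Finset L) = {p, r, q} by grind)
  have h₄ (p q r s) : c₄ p q r s = c₄ q p r s :=
    NonemptyFiniteChains.ext (show ({p, q, r, s} : Finset L) = {q, p, r, s} by grind)
  have h₄' (p q r s) : c₄ p q r s = c₄ p r q s :=
    NonemptyFiniteChains.ext (show ({p, q, r, s} : Finset L) = {p, r, q, s} by grind)
  have h₄'' (p q r s) : c₄ p q r s = c₄ p q s r :=
    NonemptyFiniteChains.ext (show ({p, q, r, s} : Finset L) = {p, q, s, r} by grind)
  -- These are the faces omitting the first, second and third set of the flag. Each forgets the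
  -- order of two adjacent letters, hence the symmetries.
  refine ⟨fun p q r s => twoCocycleValue σ (g p q r) (h p q r s),
    fun p q r s => twoCocycleValue σ (f p q ≫ g p q r) (h p q r s),
    fun p q r s => twoCocycleValue σ (f p q) (g p q r ≫ h p q r s),
    fun p q r s => ?_, fun p q r s => ?_, fun p q r s => ?_, fun p q r s => ?_⟩
  · have := twoCocycleValue_coboundary σ (f p q) (g p q r) (h p q r s)
    have e : flagValue ht σ p q r = twoCocycleValue σ (f p q) (g p q r) := rfl
    grind
  · exact twoCocycleValue_congr σ _ _ _ _ (h₂ p q) (h₃ p q r) (h₄ p q r s)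
  · exact twoCocycleValue_congr σ _ _ _ _ rfl (h₃' p q r) (h₄' p q r s)
  · exact twoCocycleValue_congr σ _ _ _ _ rfl rfl (h₄'' p q r s)

/-- The coboundary is a sum over all 24 orderings of `a, b, c, d`. The interior faces `u`, `v`, `w`
cancel in pairs modulo 2 under their transpositions. -/
lemma isTwoCocycle_flagSum (σ : nerve (NonemptyFiniteChains L) ⟶ twoCocycles) :
    IsTwoCocycle (flagSum ht σ) := by
  refine ⟨fun a b c d => ?_, fun a => ?_⟩
  · obtain ⟨u, v, w, h, hu, hv, hw⟩ := exists_flagValue_coboundary ht σ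
    have hF (p q r s) : flagValue ht σ p q r = u p q r s + v p q r s + w p q r s := by
      have := h p q r s
      grind
    have two : (2 : ZMod 2) = 0 := rfl
    simp only [flagSum]
    rw [hF b c d a, hF b d c a, hF c b d a, hF c d b a, hF d b c a, hF d c b a,
      hF a c d b, hF a d c b, hF c a d b, hF c d a b, hF d a c b, hF d c a b,
      hF a b d c, hF a d b c, hF b a d c, hF b d a c, hF d a b c, hF d b a c,
      hF a b c d, hF a c b d, hF b a c d, hF b c a d, hF c a b d, hF c b a d]
    rw [hu b a c d, hu b a d c, hu c a b d, hu c a d b, hu d a b c, hu d a c b,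
      hu c b a d, hu c b d a, hu d b a c, hu d b c a, hu d c a b, hu d c b a]
    rw [hv a c b d, hv a d b c, hv a d c b, hv b c a d, hv b d a c, hv b d c a,
      hv c b a d, hv c d a b, hv c d b a, hv d b a c, hv d c a b, hv d c b a]
    rw [hw a b d c, hw a c d b, hw a d c b, hw b a d c, hw b c d a, hw b d c a,
      hw c a d b, hw c b d a, hw c d b a, hw d a c b, hw d b c a, hw d c b a]
    ring_nf
    simp [two]
  · have two : (2 : ZMod 2) = 0 := rfl
    simp only [flagSum]
    linear_combination (3 * flagValue ht σ a a a) * two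

lemma flagSum_nerveMap_comp (f : L →o L')
    (σ : nerve (NonemptyFiniteChains L') ⟶ twoCocycles) (a b c : L) :
    flagSum ht (nerveMap (NonemptyFiniteChains.orderHomMap f).monotone.functor ≫ σ) a b c =
      flagSum ht' σ (f a) (f b) (f c) := by
  have h (p q r) : flagValue ht
      (nerveMap (NonemptyFiniteChains.orderHomMap f).monotone.functor ≫ σ) p q r =
      flagValue ht' σ (f p) (f q) (f r) := by
    rw [flagValue, twoCocycleValue_nerveMap_comp]
    refine twoCocycleValue_congr _ _ _ _ _ (NonemptyFiniteChains.ext ?_)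
      (NonemptyFiniteChains.ext ?_) (NonemptyFiniteChains.ext ?_) <;>
    · ext x
      refine (NonemptyFiniteChains.mem_map_iff _ f x).trans ?_
      simp [finChain, eq_comm]
  simp only [flagSum, h]

end Subdivision

/-! ### Last vertex map and retraction from `Ex` -/

section LastVertex

open PartialOrder

lemma ulift_fin_total {n : ℕ} (a b : ULift.{0} (Fin n)) : a ≤ b ∨ b ≤ a :=
  le_total a.down b.down

/-- The retraction `Ex K ⟶ K` given by the subdivision operator on cochains. -/
noncomputable def exTwoCocycles : SSet.ex.obj twoCocycles ⟶ twoCocycles where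
  app n := ↾fun x => ⟨fun a b c => flagSum ulift_fin_total
      (show nerve (NonemptyFiniteChains (ULift.{0} (Fin (n.unop.len + 1)))) ⟶ twoCocycles
        from x.down) ⟨a⟩ ⟨b⟩ ⟨c⟩,
    (isTwoCocycle_flagSum ulift_fin_total _).comp ULift.up⟩
  naturality n m θ := by
    ext x
    refine Subtype.ext (funext fun a => funext fun b => funext fun c => ?_)
    exact flagSum_nerveMap_comp ulift_fin_total ulift_fin_total
      (SimplexCategory.toPartOrd.map θ.unop).hom _ _ _ _

/-- The greatest element of a nonempty set of vertices of a simplex. -/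
def lastVertex {n : ℕ} (s : NonemptyFiniteChains (ULift.{0} (Fin n))) : Fin n :=
  (s.finset.image ULift.down).max' (s.nonempty.image _)

lemma lastVertex_mono {n : ℕ} : Monotone (lastVertex (n := n)) := fun s _ h =>
  Finset.max'_subset (s.nonempty.image _) (Finset.image_subset_image h)

lemma lastVertex_eq {n : ℕ} (s : NonemptyFiniteChains (ULift.{0} (Fin n))) (i : Fin n)
    (hi : ⟨i⟩ ∈ s.finset) (h : ∀ j ∈ s.finset, j.down ≤ i) : lastVertex s = i :=
  le_antisymm (Finset.max'_le _ _ _ (by simpa using fun j hj => h ⟨j⟩ hj))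
    (Finset.le_max' _ _ (Finset.mem_image_of_mem ULift.down hi))

lemma lastVertex_mem {n : ℕ} (s : NonemptyFiniteChains (ULift.{0} (Fin n))) :
    ⟨lastVertex s⟩ ∈ s.finset := by
  obtain ⟨x, hx, h⟩ := Finset.mem_image.1 (Finset.max'_mem _ (s.nonempty.image ULift.down))
  have : x = ⟨lastVertex s⟩ := ULift.ext _ _ h
  exact this ▸ hx

lemma le_lastVertex {n : ℕ} (s : NonemptyFiniteChains (ULift.{0} (Fin n))) (j)
    (hj : j ∈ s.finset) : j.down ≤ lastVertex s :=
  Finset.le_max' _ _ (Finset.mem_image_of_mem ULift.down hj)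

/-- The last vertex map, from the subdivision of a simplex to the simplex. -/
noncomputable def lastVertexMap : SimplexCategory.sd.{0} ⟶ SSet.stdSimplex where
  app n :=
    { app m := ↾fun x => SSet.stdSimplex.objEquiv.symm (SimplexCategory.Hom.mk
        ((⟨lastVertex, lastVertex_mono⟩ :
          NonemptyFiniteChains (ULift.{0} (Fin (n.len + 1))) →o Fin (n.len + 1)).comp
          ⟨(show ComposableArrows (NonemptyFiniteChains (ULift.{0} (Fin (n.len + 1)))) _
            from x).obj, Functor.monotone _⟩))
      naturality _ _ _ := rfl }
  naturality n m θ := by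
    ext k x
    apply SSet.stdSimplex.objEquiv.injective
    ext j
    -- A monotone map sends the maximum of a set to the maximum of its image.
    refine congrArg Fin.val (lastVertex_eq _ _ ?_ ?_)
    · exact (NonemptyFiniteChains.mem_map_iff _ _ _).2 ⟨_, lastVertex_mem _, rfl⟩
    · intro i hi
      obtain ⟨x, hx, rfl⟩ := (NonemptyFiniteChains.mem_map_iff _ _ _).1 hi
      exact θ.toOrderHom.monotone (le_lastVertex _ x hx)

/-- The last vertex transformation `X ⟶ Ex X`. -/
noncomputable def toEx : 𝟭 SSet.{0} ⟶ SSet.ex where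
  app X :=
    { app n := ↾fun x => ULift.up (lastVertexMap.app n.unop ≫ SSet.yonedaEquiv.symm x)
      naturality n m θ := by
        ext x
        refine congrArg ULift.up ?_
        change lastVertexMap.app m.unop ≫ SSet.yonedaEquiv.symm (X.map θ x) =
          SimplexCategory.sd.map θ.unop ≫ lastVertexMap.app n.unop ≫ SSet.yonedaEquiv.symm x
        rw [lastVertexMap.naturality_assoc θ.unop (SSet.yonedaEquiv.symm x)]
        congr 1
        exact (SSet.yonedaEquiv_symm_naturality_left θ.unop x).symm }
  naturality X Y f := by
    ext n x
    refine congrArg ULift.up ?_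
    change lastVertexMap.app n.unop ≫ SSet.yonedaEquiv.symm (f.app n x) =
      (lastVertexMap.app n.unop ≫ SSet.yonedaEquiv.symm x) ≫ f
    rw [Category.assoc]
    congr 1
    exact (SSet.yonedaEquiv_symm_comp x f).symm

lemma twoCocycleValue_lastVertexMap_comp (φ : twoCocycles _⦋2⦌)
    {s t u : NonemptyFiniteChains (ULift.{0} (Fin 3))} (f : s ⟶ t) (g : t ⟶ u) :
    twoCocycleValue (show nerve (NonemptyFiniteChains (ULift.{0} (Fin 3))) ⟶ twoCocycles
        from lastVertexMap.app ⦋2⦌ ≫ SSet.yonedaEquiv.symm φ) f g =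
      φ.1 (lastVertex s) (lastVertex t) (lastVertex u) :=
  rfl

/-- Last vertices turn the flag of `p, q, r` into `p, p ⊔ q, p ⊔ q ⊔ r`. Only the ordering 0, 1, 2
gives a nondegenerate triangle, and normalized cocycles vanish on the others. -/
lemma exTwoCocycles_toEx (φ : twoCocycles _⦋2⦌) :
    (exTwoCocycles.app (op ⦋2⦌) ((toEx.app twoCocycles).app (op ⦋2⦌) φ)).1
      (0 : Fin 3) (1 : Fin 3) (2 : Fin 3) = φ.1 (0 : Fin 3) (1 : Fin 3) (2 : Fin 3) := by
  have h (p q r : Fin 3) : flagValue ulift_fin_total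
      (show nerve (NonemptyFiniteChains (ULift.{0} (Fin 3))) ⟶ twoCocycles
        from lastVertexMap.app ⦋2⦌ ≫ SSet.yonedaEquiv.symm φ) ⟨p⟩ ⟨q⟩ ⟨r⟩ =
      φ.1 p (p ⊔ q) (p ⊔ q ⊔ r) := by
    rw [flagValue, twoCocycleValue_lastVertexMap_comp, lastVertex_eq _ p (by simp [finChain]) (by simp [finChain]),
      lastVertex_eq _ (p ⊔ q) ?_ (by simp [finChain]),
      lastVertex_eq _ (p ⊔ q ⊔ r) ?_ (by simp [finChain])]
    · rcases le_total (p ⊔ q) r with h | h <;> rcases le_total p q with h' | h' <;>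
        simp_all [finChain]
    · rcases le_total p q with h | h <;> simp [finChain, h]
  change flagSum ulift_fin_total (show nerve (NonemptyFiniteChains (ULift.{0} (Fin 3))) ⟶
    twoCocycles from lastVertexMap.app ⦋2⦌ ≫ SSet.yonedaEquiv.symm φ) ⟨0⟩ ⟨1⟩ ⟨2⟩ = _
  simp only [flagSum, h]
  have h₁ := φ.2.right_eq_zero (0 : Fin 3) (2 : Fin 3)
  have h₂ := φ.2.left_eq_zero (1 : Fin 3) (2 : Fin 3)
  have h₃ := φ.2.right_eq_zero (1 : Fin 3) (2 : Fin 3)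
  have h₄ := φ.2.diag (2 : Fin 3)
  change φ.1 (0 : Fin 3) (1 : Fin 3) (2 : Fin 3) + φ.1 (0 : Fin 3) (2 : Fin 3) (2 : Fin 3) +
    φ.1 (1 : Fin 3) (1 : Fin 3) (2 : Fin 3) + φ.1 (1 : Fin 3) (2 : Fin 3) (2 : Fin 3) +
    φ.1 (2 : Fin 3) (2 : Fin 3) (2 : Fin 3) + φ.1 (2 : Fin 3) (2 : Fin 3) (2 : Fin 3) = _
  rw [h₁, h₂, h₃, h₄]
  simp

end LastVertex

/-! ### Extending cocycles along a weak equivalence -/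

/-- If a Thomason weak equivalence `d : D ⟶ E` factors through `j : D ⟶ T`,
where `j` is injective on nerves, any 2-cocycle on the nerve of `D` extends to the nerve of `T`. -/
lemma exists_twoCocycle_extension {D E T : Cat.{0, 0}} {d : D ⟶ E}
    (hd : thomasonWeakEquivalences d) (j : D ⟶ T) (t : T ⟶ E) (fac : j ≫ t = d)
    [Mono (nerveFunctor.map j)] (w : nerveFunctor.obj D ⟶ twoCocycles) :
    ∃ v : nerveFunctor.obj T ⟶ twoCocycles, ∀ {x y z : D} (f : x ⟶ y) (g : y ⟶ z),
      twoCocycleValue (C := T) v (j.toFunctor.map f) (j.toFunctor.map g) = twoCocycleValue (C := D) w f g := by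
  obtain ⟨Z, i, p, hi, hp, hip⟩ : ∃ (Z : SSet.{0}) (i : SSet.ex.obj (SSet.ex.obj (nerveFunctor.obj D)) ⟶ Z)
      (p : Z ⟶ SSet.ex.obj (SSet.ex.obj (nerveFunctor.obj E))), SSet.anodyneExtensions i ∧
      (MorphismProperty.monomorphisms SSet.{0}).rlp p ∧
      i ≫ p = SSet.ex.map (SSet.ex.map (nerveFunctor.map d)) := hd
  have := kanComplex_twoCocycles
  let w' : SSet.ex.obj (SSet.ex.obj (nerveFunctor.obj D)) ⟶ twoCocycles :=
    SSet.ex.map (SSet.ex.map w) ≫ SSet.ex.map exTwoCocycles ≫ exTwoCocycles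
  let η (X : SSet.{0}) : X ⟶ SSet.ex.obj (SSet.ex.obj X) :=
    toEx.app X ≫ toEx.app (SSet.ex.obj X)
  have hη {X Y : SSet.{0}} (f : X ⟶ Y) : f ≫ η Y = η X ≫ SSet.ex.map (SSet.ex.map f) := by
    have h1 := toEx.naturality f
    have h2 := toEx.naturality (SSet.ex.map f)
    dsimp at h1 h2
    simp only [η, Category.assoc, ← h2]
    rw [reassoc_of% h1]
  obtain ⟨g', hg'⟩ := hi.exists_extension w'
  -- As `p` lifts against monomorphisms, the nerve of `T` maps to `Z`, where `g'` extends `w'`.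
  have lift := hp (nerveFunctor.map j) (MorphismProperty.monomorphisms.infer_property _)
  have sq : CommSq (η (nerveFunctor.obj D) ≫ i) (nerveFunctor.map j) p
      (nerveFunctor.map t ≫ η (nerveFunctor.obj E)) := ⟨by
    rw [Category.assoc, hip, ← Category.assoc, ← Functor.map_comp, fac]
    exact (hη _).symm⟩
  refine ⟨sq.lift ≫ g', fun {x y z} f g => ?_⟩
  -- By naturality of `toEx`, the passage through `Ex²` splits into two rounds of `toEx` followed by
  -- `exTwoCocycles`.
  have key : nerveFunctor.map j ≫ sq.lift ≫ g' =
      w ≫ toEx.app twoCocycles ≫ exTwoCocycles ≫ toEx.app twoCocycles ≫ exTwoCocycles := by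
    rw [sq.fac_left_assoc, Category.assoc, hg']
    have h3 := toEx.naturality exTwoCocycles
    dsimp at h3
    rw [reassoc_of% h3]
    have h4 := hη w
    simp only [w']
    rw [← reassoc_of% h4]
    simp [η]
  refine (twoCocycleValue_nerveMap_comp j.toFunctor (sq.lift ≫ g' : nerve T ⟶ twoCocycles)
    f g).symm.trans ?_
  refine (congrArg (fun σ : nerve D ⟶ twoCocycles => twoCocycleValue σ f g) key).trans ?_
  exact (exTwoCocycles_toEx _).trans (exTwoCocycles_toEx _)

/-- The inclusion of a category in its cone, obtained by adding a terminal object. -/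
def coneIncl (D : Cat.{0, 0}) : D ⟶ Cat.of (WithTerminal D) :=
  (WithTerminal.incl (C := D)).toCatHom

instance (D : Cat.{0, 0}) : Mono (nerveFunctor.map (coneIncl D)) := by
  rw [NatTrans.mono_iff_mono_app]
  intro n
  rw [mono_iff_injective]
  intro F G h
  have h' : (show Fin (n.unop.len + 1) ⥤ D from F) ⋙ WithTerminal.incl =
    (show Fin (n.unop.len + 1) ⥤ D from G) ⋙ WithTerminal.incl := h
  have hobj (x) : (show Fin (n.unop.len + 1) ⥤ D from F).obj x =
      (show Fin (n.unop.len + 1) ⥤ D from G).obj x :=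
    WithTerminal.of.inj (Functor.congr_obj h' x)
  refine Functor.hext hobj fun x y f => ?_
  exact Functor.hcongr_hom h' f

/-! ### The octahedron and its fundamental cocycle -/

section Octahedron

/-- The vertices of the octahedron, regarded as the minimal finite model of the 2-sphere. -/
structure Octahedron where
  /-- The dimension of the corresponding cell of the sphere. -/
  level : Fin 3
  /-- The two cells of each dimension. -/
  sign : Bool
  deriving DecidableEq

namespace Octahedron

instance : PartialOrder Octahedron where
  le x y := x.level < y.level ∨ x = y
  le_refl _ := Or.inr rfl
  le_trans _ _ _ := by
    rintro (h | rfl) (h' | rfl)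
    exacts [Or.inl (h.trans h'), Or.inl h, Or.inl h', Or.inr rfl]
  le_antisymm _ _ := by
    rintro (h | rfl) (h' | h')
    exacts [absurd h h'.asymm, h'.symm, rfl, rfl]

lemma le_iff (x y : Octahedron) : x ≤ y ↔ x.level < y.level ∨ x = y := Iff.rfl

/-- The indicator function of the triangle with positive vertices. -/
def orientation (x y z : Octahedron) : ZMod 2 :=
  if x.sign ∧ y.sign ∧ z.sign ∧ x ≠ y ∧ y ≠ z ∧ x ≠ z then 1 else 0

lemma orientation_swap_left (x y z : Octahedron) : orientation x y z = orientation y x z :=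
  if_congr (by grind) rfl rfl

lemma orientation_swap_right (x y z : Octahedron) : orientation x y z = orientation x z y :=
  if_congr (by grind) rfl rfl

lemma orientation_self_left (x y : Octahedron) : orientation x x y = 0 :=
  if_neg (by simp)

/-- With only three levels, two of four pairwise comparable vertices coincide. The terms then vanish
or cancel by symmetry of `orientation`. -/
lemma orientation_coboundary (x y z t : Octahedron) (hxy : x ≤ y ∨ y ≤ x) (hxz : x ≤ z ∨ z ≤ x)
    (hxt : x ≤ t ∨ t ≤ x) (hyz : y ≤ z ∨ z ≤ y) (hyt : y ≤ t ∨ t ≤ y) (hzt : z ≤ t ∨ t ≤ z) :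
    orientation y z t + orientation x z t + orientation x y t + orientation x y z = 0 := by
  have two (u : ZMod 2) : u + u = 0 := CharTwo.add_self_eq_zero u
  have eq_of_level {x y : Octahedron} (h : x ≤ y ∨ y ≤ x) (hl : x.level = y.level) : x = y := by
    simp only [le_iff, hl, lt_irrefl, false_or] at h
    exact h.elim id Eq.symm
  have h : x = y ∨ x = z ∨ x = t ∨ y = z ∨ y = t ∨ z = t := by
    have : x.level = y.level ∨ x.level = z.level ∨ x.level = t.level ∨ y.level = z.level ∨
      y.level = t.level ∨ z.level = t.level := by omega
    exact this.imp (eq_of_level hxy) <| .imp (eq_of_level hxz) <| .imp (eq_of_level hxt) <|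
      .imp (eq_of_level hyz) <| .imp (eq_of_level hyt) (eq_of_level hzt)
  rcases h with rfl | rfl | rfl | rfl | rfl | rfl
  all_goals grind [orientation_swap_left, orientation_swap_right, orientation_self_left]

/-- The fundamental 2-cocycle of the octahedron. -/
def fundamentalCocycle : nerve Octahedron ⟶ twoCocycles where
  app n := ↾fun x => ⟨fun a b c => orientation
      ((show Fin (n.unop.len + 1) ⥤ Octahedron from x).obj a)
      ((show Fin (n.unop.len + 1) ⥤ Octahedron from x).obj b)
      ((show Fin (n.unop.len + 1) ⥤ Octahedron from x).obj c), by
    have h (a b) : (show Fin (n.unop.len + 1) ⥤ Octahedron from x).obj a ≤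
        (show Fin (n.unop.len + 1) ⥤ Octahedron from x).obj b ∨
        (show Fin (n.unop.len + 1) ⥤ Octahedron from x).obj b ≤
        (show Fin (n.unop.len + 1) ⥤ Octahedron from x).obj a :=
      (le_total a b).imp (fun h => Functor.monotone _ h) (fun h => Functor.monotone _ h)
    exact ⟨fun a b c d => orientation_coboundary _ _ _ _ (h _ _) (h _ _) (h _ _) (h _ _) (h _ _)
      (h _ _), fun a => if_neg (by simp)⟩⟩
  naturality _ _ _ := rfl

end Octahedron

end Octahedron

/-! ### The cocone over `d` with vertex the image of `111` -/

lemma CategoryTheory.Functor.toOver_congr {S T : Type*} [Category* S] [Category* T] {F F' : S ⥤ T}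
    (hF : F = F') {X : T} (f : ∀ s, F.obj s ⟶ X) (f' : ∀ s, F'.obj s ⟶ X)
    (h : ∀ {s t : S} (g : s ⟶ t), F.map g ≫ f t = f s)
    (h' : ∀ {s t : S} (g : s ⟶ t), F'.map g ≫ f' t = f' s)
    (hf : ∀ s, f' s = eqToHom (Functor.congr_obj hF s).symm ≫ f s) :
    F.toOver X f h = F'.toOver X f' h' := by
  subst hF
  obtain rfl : f' = f := funext fun s => by simpa using hf s
  rfl

/-- A cocone on a functor from a pushout of categories is glued from compatible cocones. -/
lemma exists_cocone_of_isPushout {C A B D E : Cat.{0, 0}} {f : C ⟶ A} {g : C ⟶ B} {i : A ⟶ D}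
    {j : B ⟶ D} (hD : IsPushout f g i j) (d : D ⟶ E) (X : E)
    (M : ∀ x : A, (i ≫ d).toFunctor.obj x ⟶ X) (N : ∀ x : B, (j ≫ d).toFunctor.obj x ⟶ X)
    (hM : ∀ {x y : A} (u : x ⟶ y), (i ≫ d).toFunctor.map u ≫ M y = M x)
    (hN : ∀ {x y : B} (u : x ⟶ y), (j ≫ d).toFunctor.map u ≫ N y = N x)
    (hMN : ∀ (c : C) (h : (j ≫ d).toFunctor.obj (g.toFunctor.obj c) =
      (i ≫ d).toFunctor.obj (f.toFunctor.obj c)),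
      N (g.toFunctor.obj c) = eqToHom h ≫ M (f.toFunctor.obj c)) :
    ∃ P : ∀ x : D, d.toFunctor.obj x ⟶ X,
      ∀ {x y : D} (u : x ⟶ y), d.toFunctor.map u ≫ P y = P x := by
  -- A cocone with vertex `X` is a lift to `Over X`, so gluing cocones is the universal property of
  -- `D` applied to `Over X`.
  let GA : A ⟶ Cat.of (Over X) := ((i ≫ d).toFunctor.toOver X M hM).toCatHom
  let GB : B ⟶ Cat.of (Over X) := ((j ≫ d).toFunctor.toOver X N hN).toCatHom
  have w : f ≫ i ≫ d = g ≫ j ≫ d := by rw [hD.w_assoc]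
  have hG : f ≫ GA = g ≫ GB := congrArg Functor.toCatHom <|
    Functor.toOver_congr (congrArg Cat.Hom.toFunctor w) (fun c => M (f.toFunctor.obj c))
      (fun c => N (g.toFunctor.obj c)) (fun _ => hM _) (fun _ => hN _) (fun c => hMN c _)
  obtain ⟨G, rfl⟩ : ∃ G : D ⟶ Cat.of (Over X), G ≫ (Over.forget X).toCatHom = d :=
    ⟨hD.desc GA GB hG, hD.hom_ext (by rw [hD.inl_desc_assoc]; rfl)
      (by rw [hD.inr_desc_assoc]; rfl)⟩
  exact ⟨fun x => (G.toFunctor.obj x).hom, fun u => Over.w (G.toFunctor.map u)⟩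

/-- The morphism of `posetCat P` given by an inequality. -/
def posetHom (P : Type) [PartialOrder P] {x y : P} (h : x ≤ y) :
    Quiver.Hom (V := posetCat P) x y :=
  @homOfLE P _ x y h

lemma posetHom_eq {P : Type} [PartialOrder P] {x y : posetCat P} (u v : x ⟶ y) : u = v :=
  have (x y : P) (u v : x ⟶ y) : u = v := Subsingleton.elim _ _
  this x y u v

lemma le_of_posetHom {P : Type} [PartialOrder P] {x y : posetCat P} (u : x ⟶ y) :
    @LE.le P _ x y :=
  leOfHom (X := P) u

lemma map_posetHom_comp {P : Type} [PartialOrder P] {E : Type*} [Category* E] (F : posetCat P ⥤ E)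
    {x y z : P} (h : x ≤ y) (h' : y ≤ z) {X : E} (k : F.obj z ⟶ X) :
    F.map (posetHom P h) ≫ F.map (posetHom P h') ≫ k = F.map (posetHom P (h.trans h')) ≫ k :=
  (F.map_comp_assoc _ _ _).symm

/-- The vertex of `C` whose only nonzero coordinate is `i`, joined with the one for `j`. -/
def hexagonVertex (i j : Fin 3) : CubeC :=
  ⟨⟨fun k => if k = i ∨ k = j then 1 else 0, fun h => by
    obtain ⟨k, hk⟩ : ∃ k : Fin 3, ¬ (k = i ∨ k = j) := by
      revert i j
      decide
    simpa [hk] using congrFun h k⟩, fun h => by simpa using congrFun h i⟩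

lemma hexagonVertex_le (i j : Fin 3) (b : CubeB) (hi : b i ≠ 0) (hj : b j ≠ 0) :
    (hexagonVertex i j).1.1 ≤ b := by
  intro k
  by_cases h : k = i ∨ k = j
  · simp only [hexagonVertex, h, if_true]
    rcases h with rfl | rfl <;> omega
  · simp [hexagonVertex, h]

lemma exists_coord_ne_zero (b : CubeB) (hb : b ≠ fun _ => 0) : ∃ i, b i ≠ 0 := by
  by_contra! h
  exact hb (funext h)

lemma exists_hexagon_ge (x : CubeA) : ∃ c : CubeC, x ≤ c.1 := by
  by_cases hx : x.1 = fun _ => 0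
  · exact ⟨hexagonVertex 0 0, fun i => by simp [hx]⟩
  · exact ⟨⟨x, hx⟩, le_rfl⟩

/-- The hexagon `C` is connected. -/
lemma hexagon_constant {α : Type*} (ν : CubeC → α) (hν : ∀ c c', c ≤ c' → ν c = ν c')
    (c c' : CubeC) : ν c = ν c' := by
  obtain ⟨i, hi⟩ := exists_coord_ne_zero c.1.1 c.2
  obtain ⟨j, hj⟩ := exists_coord_ne_zero c'.1.1 c'.2
  -- The zigzag runs from `c` down to `i`, up to `i ∨ j`, down to `j`, and up to `c'`.
  rw [← hν (hexagonVertex i i) c (hexagonVertex_le i i _ hi hi),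
    ← hν (hexagonVertex j j) c' (hexagonVertex_le j j _ hj hj),
    hν (hexagonVertex i i) (hexagonVertex i j)
      (hexagonVertex_le i i _ (by simp [hexagonVertex]) (by simp [hexagonVertex])),
    hν (hexagonVertex j j) (hexagonVertex i j)
      (hexagonVertex_le j j _ (by simp [hexagonVertex]) (by simp [hexagonVertex]))]

/-- The image of the top vertex of the cube `B` is the vertex of a cocone on `D ⟶ E`. -/
lemma exists_cocone_of_cube {D E : Cat.{0, 0}} {a a' : posetCat CubeA ⟶ D}
    (hD : IsPushout inclCA inclCA a a') {d : D ⟶ E} {b : posetCat CubeB ⟶ E}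
    (w : a ≫ d = inclAB ≫ b) :
    ∃ (X : E) (P : ∀ x : D, d.toFunctor.obj x ⟶ X),
      ∀ {x y : D} (u : x ⟶ y), d.toFunctor.map u ≫ P y = P x := by
  let X : E := b.toFunctor.obj (fun _ => 1 : CubeB)
  have le_one (x : CubeB) : x ≤ fun _ => 1 := fun i => by
    change x i ≤ 1
    omega
  obtain ⟨M, hM⟩ : ∃ M : ∀ x : posetCat CubeA, (a ≫ d).toFunctor.obj x ⟶ X,
      ∀ {x y : posetCat CubeA} (u : x ⟶ y), (a ≫ d).toFunctor.map u ≫ M y = M x := by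
    rw [w]
    refine ⟨fun x => b.toFunctor.map (posetHom CubeB (le_one (show CubeA from x).1)), fun u => ?_⟩
    exact (b.toFunctor.map_comp _ _).symm.trans (congrArg _ (posetHom_eq _ _))
  have w' : inclCA ≫ a' ≫ d = inclCA ≫ a ≫ d := by rw [hD.w_assoc]
  have eqC (c : CubeC) : (a' ≫ d).toFunctor.obj c.1 = (a ≫ d).toFunctor.obj c.1 :=
    Functor.congr_obj (congrArg Cat.Hom.toFunctor w') (show posetCat CubeC from c)
  let ν (c : CubeC) : (a' ≫ d).toFunctor.obj c.1 ⟶ X := eqToHom (eqC c) ≫ M c.1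
  have hν (c c' : CubeC) (h : c ≤ c') :
      (a' ≫ d).toFunctor.map (posetHom CubeA (show c.1 ≤ c'.1 from h)) ≫ ν c' = ν c := by
    have h1 := Functor.congr_hom (congrArg Cat.Hom.toFunctor w') (posetHom CubeC h)
    have h2 : (a' ≫ d).toFunctor.map (posetHom CubeA (show c.1 ≤ c'.1 from h)) =
      eqToHom (eqC c) ≫ (a ≫ d).toFunctor.map (posetHom CubeA (show c.1 ≤ c'.1 from h)) ≫
        eqToHom (eqC c').symm := h1
    have h3 := hM (posetHom CubeA (show c.1 ≤ c'.1 from h))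
    simp only [ν]
    rw [h2, ← h3]
    simp
  -- The leg at `x` does not depend on the vertex of `C` through which it passes. At `000` this is
  -- exactly the connectedness of the hexagon.
  have hν' (x : CubeA) (c c' : CubeC) (h : x ≤ c.1) (h' : x ≤ c'.1) :
      (a' ≫ d).toFunctor.map (posetHom CubeA h) ≫ ν c = (a' ≫ d).toFunctor.map (posetHom CubeA h') ≫ ν c' := by
    have step (c c' : CubeC) (h : x ≤ c.1) (hc : c ≤ c') :
        (a' ≫ d).toFunctor.map (posetHom CubeA h) ≫ ν c =
          (a' ≫ d).toFunctor.map (posetHom CubeA (h.trans hc)) ≫ ν c' := by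
      rw [← hν c c' hc]
      exact map_posetHom_comp (a' ≫ d).toFunctor h hc _
    by_cases hx : x.1 = fun _ => 0
    · have h0 (c : CubeC) : x ≤ c.1 := fun i => by simp [hx]
      exact hexagon_constant (fun c => (a' ≫ d).toFunctor.map (posetHom CubeA (h0 c)) ≫ ν c)
        (fun c c' hc => step c c' _ hc) c c'
    · exact (step ⟨x, hx⟩ c le_rfl h).symm.trans (step ⟨x, hx⟩ c' le_rfl h')
  choose γ hγ using exists_hexagon_ge
  refine ⟨X, exists_cocone_of_isPushout hD d X M
    (fun x => (a' ≫ d).toFunctor.map (posetHom CubeA (hγ x)) ≫ ν (γ x)) hM (fun {x y} u => ?_)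
    (fun c h => ?_)⟩
  · refine (map_posetHom_comp (a' ≫ d).toFunctor (le_of_posetHom u) (hγ y) _).trans ?_
    exact hν' x _ _ ((le_of_posetHom u).trans (hγ y)) (hγ x)
  · refine (hν' (show CubeC from c).1 _ c _ le_rfl).trans ?_
    exact (congrArg (· ≫ ν c) ((a' ≫ d).toFunctor.map_id _)).trans (Category.id_comp _)

namespace Octahedron

/-- Since `111` is excluded the coordinate sums are at most 2, so `Fin.ofNat 3` never wraps around.
-/
lemma cell_strictMono : ∀ x₀ x₁ x₂ y₀ y₁ y₂ : Fin 2, x₀ ≤ y₀ → x₁ ≤ y₁ → x₂ ≤ y₂ →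
    ¬ (y₀ = 1 ∧ y₁ = 1 ∧ y₂ = 1) →
    Fin.ofNat 3 (x₀ + x₁ + x₂ : ℕ) < Fin.ofNat 3 (y₀ + y₁ + y₂ : ℕ) ∨
      (x₀ = y₀ ∧ x₁ = y₁ ∧ x₂ = y₂) := by
  decide

/-- The map of posets from `A` to the octahedron which sends `000` to the vertex of level zero
with the given sign, and the chain `100 < 110` to vertices with positive signs. -/
def cell (s : Bool) : CubeA →o Octahedron where
  toFun x := ⟨Fin.ofNat 3 (x.1 0 + x.1 1 + x.1 2 : ℕ),
    if x.1 = fun _ => 0 then s else decide (x.1 0 = 1 ∧ x.1 2 = 0)⟩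
  monotone' x y h := by
    have hy : ¬ (y.1 0 = 1 ∧ y.1 1 = 1 ∧ y.1 2 = 1) := fun ⟨h₀, h₁, h₂⟩ =>
      y.2 (funext fun k => by fin_cases k <;> assumption)
    rcases cell_strictMono _ _ _ _ _ _ (h 0) (h 1) (h 2) hy with h | ⟨h₀, h₁, h₂⟩
    · exact Or.inl h
    · obtain rfl : x = y := Subtype.ext (funext fun k => by fin_cases k <;> assumption)
      exact le_rfl

end Octahedron

/-! ### The cocycle on `D` and the contradiction -/

/-- The pullback to `D` of the fundamental cocycle of the octahedron, on the two copies of `A`. -/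
lemma exists_twoCocycle_pushout {D : Cat.{0, 0}} {a a' : posetCat CubeA ⟶ D}
    (hD : IsPushout inclCA inclCA a a') :
    ∃ w : nerve D ⟶ twoCocycles, ∀ {x y z : CubeA} (h : x ≤ y) (h' : y ≤ z),
      twoCocycleValue w (a.toFunctor.map (posetHom CubeA h)) (a.toFunctor.map (posetHom CubeA h')) =
        Octahedron.orientation (.cell true x) (.cell true y) (.cell true z) ∧
      twoCocycleValue w (a'.toFunctor.map (posetHom CubeA h))
          (a'.toFunctor.map (posetHom CubeA h')) =
        Octahedron.orientation (.cell false x) (.cell false y) (.cell false z) := by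
  let F (s : Bool) : posetCat CubeA ⟶ posetCat Octahedron :=
    preordToCat.map (Preord.ofHom (Octahedron.cell s))
  -- The sign parameter is used only at `000`, which is not in `C`.
  have hF : inclCA ≫ F true = inclCA ≫ F false := by
    refine congrArg preordToCat.map (Preord.ext (X := .of CubeC) (Y := .of Octahedron)
      (f := Preord.ofHom ((Octahedron.cell true).comp (OrderHom.Subtype.val _)))
      (g := Preord.ofHom ((Octahedron.cell false).comp (OrderHom.Subtype.val _)))
      fun x => ?_)
    exact congrArg (Octahedron.mk _) ((if_neg x.2).trans (if_neg x.2).symm)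
  have h₁ := hD.inl_desc _ _ hF
  have h₂ := hD.inr_desc _ _ hF
  set G := hD.desc _ _ hF
  refine ⟨nerveMap G.toFunctor ≫ Octahedron.fundamentalCocycle, fun {x y z} h h' => ⟨?_, ?_⟩⟩
  · have e (x : CubeA) : G.toFunctor.obj (a.toFunctor.obj x) = Octahedron.cell true x :=
      Functor.congr_obj (congrArg Cat.Hom.toFunctor h₁) x
    refine (twoCocycleValue_nerveMap_comp (D := Octahedron) G.toFunctor _ _ _).trans ?_
    exact (twoCocycleValue_congr (Q := Octahedron) _ _ _ (homOfLE ((Octahedron.cell true).monotone h))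
      (homOfLE ((Octahedron.cell true).monotone h')) (e x) (e y) (e z)).trans rfl
  · have e (x : CubeA) : G.toFunctor.obj (a'.toFunctor.obj x) = Octahedron.cell false x :=
      Functor.congr_obj (congrArg Cat.Hom.toFunctor h₂) x
    refine (twoCocycleValue_nerveMap_comp (D := Octahedron) G.toFunctor _ _ _).trans ?_
    exact (twoCocycleValue_congr (Q := Octahedron) _ _ _
      (homOfLE ((Octahedron.cell false).monotone h))
      (homOfLE ((Octahedron.cell false).monotone h')) (e x) (e y) (e z)).trans rfl

/-- A 2-cocycle on the nerve of a category which extends to the cone is a coboundary. -/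
lemma exists_cobounding {D : Type} [Category.{0} D] (v : nerve (WithTerminal D) ⟶ twoCocycles) :
    ∃ e : ∀ {x y : D}, (x ⟶ y) → ZMod 2, ∀ {x y z : D} (f : x ⟶ y) (g : y ⟶ z),
      twoCocycleValue v (WithTerminal.incl.map f) (WithTerminal.incl.map g) =
        e f + e g + e (f ≫ g) := by
  refine ⟨fun {x y} f => twoCocycleValue v (WithTerminal.incl.map f) (WithTerminal.homFrom y),
    fun {x y z} f g => ?_⟩
  have h := twoCocycleValue_coboundary v (WithTerminal.incl.map f) (WithTerminal.incl.map g)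
    (WithTerminal.homFrom z)
  have hg : WithTerminal.incl.map g ≫ WithTerminal.homFrom z = WithTerminal.homFrom y :=
    Subsingleton.elim (α := (WithTerminal.incl.obj y ⟶ WithTerminal.star)) _ _
  rw [hg, ← Functor.map_comp] at h
  grind

theorem proposition4p2 (D E : Cat.{0, 0})
    (a a' : posetCat CubeA ⟶ D) (_hD : IsPushout inclCA inclCA a a')
    (d : D ⟶ E) (b : posetCat CubeB ⟶ E) (_hE : IsPushout a inclAB d b) :
    ¬ thomasonWeakEquivalences d := by
  intro hd
  obtain ⟨w, hw⟩ := exists_twoCocycle_pushout _hD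
  obtain ⟨X, P, hP⟩ := exists_cocone_of_cube _hD _hE.w
  let t : Cat.of (WithTerminal D) ⟶ E := (WithTerminal.lift d.toFunctor P fun _ _ => hP).toCatHom
  obtain ⟨v, hv⟩ := exists_twoCocycle_extension hd (coneIncl D) t rfl w
  obtain ⟨e, he⟩ := exists_cobounding v
  have ha {x y z : CubeA} (h : x ≤ y) (h' : y ≤ z) :
      Octahedron.orientation (.cell true x) (.cell true y) (.cell true z) =
        e (a.toFunctor.map (posetHom CubeA h)) + e (a.toFunctor.map (posetHom CubeA h')) +
          e (a.toFunctor.map (posetHom CubeA (h.trans h'))) := by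
    refine (hw h h').1.symm.trans ((hv _ _).symm.trans ((he _ _).trans ?_))
    exact congrArg (_ + e ·) (a.toFunctor.map_comp _ _).symm
  have ha' {x y z : CubeA} (h : x ≤ y) (h' : y ≤ z) :
      Octahedron.orientation (.cell false x) (.cell false y) (.cell false z) =
        e (a'.toFunctor.map (posetHom CubeA h)) + e (a'.toFunctor.map (posetHom CubeA h')) +
          e (a'.toFunctor.map (posetHom CubeA (h.trans h'))) := by
    refine (hw h h').2.symm.trans ((hv _ _).symm.trans ((he _ _).trans ?_))
    exact congrArg (_ + e ·) (a'.toFunctor.map_comp _ _).symm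
  have hC {x y : CubeC} (h : x ≤ y) : e (a.toFunctor.map (posetHom CubeA (x := x.1) (y := y.1) h)) =
      e (a'.toFunctor.map (posetHom CubeA (x := x.1) (y := y.1) h)) := by
    have key (F G : posetCat CubeC ⟶ D) (hFG : F = G) : e (F.toFunctor.map (posetHom CubeC h)) =
        e (G.toFunctor.map (posetHom CubeC h)) := by rw [hFG]
    exact key _ _ _hD.w
  let o : CubeA := ⟨fun _ => 0, fun h => by simpa using congrFun h 0⟩
  have ho (x : CubeA) : o ≤ x := fun i => Fin.zero_le _
  have hl (i j) : hexagonVertex i i ≤ hexagonVertex i j :=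
    hexagonVertex_le i i _ (by simp [hexagonVertex]) (by simp [hexagonVertex])
  have hr (i j) : hexagonVertex j j ≤ hexagonVertex i j :=
    hexagonVertex_le j j _ (by simp [hexagonVertex]) (by simp [hexagonVertex])
  let ω (s : Bool) (i j k : Fin 3) : ZMod 2 := Octahedron.orientation
    (.cell s o) (.cell s (hexagonVertex k k).1) (.cell s (hexagonVertex i j).1)
  let u (i) := e (a.toFunctor.map (posetHom CubeA (ho (hexagonVertex i i).1)))
  let u' (i) := e (a'.toFunctor.map (posetHom CubeA (ho (hexagonVertex i i).1)))
  -- Two adjacent triangles at the apex share the edge to `i ∨ j`, which cancels; their outer edges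
  -- lie in `C`, where the two copies agree.
  have hω (i j) : ω true i j i + ω true i j j + u i + u j =
      ω false i j i + ω false i j j + u' i + u' j := by
    have h₁ := ha (ho _) (hl i j)
    have h₂ := ha (ho _) (hr i j)
    have h₁' := ha' (ho _) (hl i j)
    have h₂' := ha' (ho _) (hr i j)
    rw [hC] at h₁ h₂
    simp only [ω, u, u']
    grind
  have h₀₁ := hω 0 1
  have h₁₂ := hω 1 2
  have h₀₂ := hω 0 2
  -- The only triangle with all signs positive is `000 < 100 < 110` in the first copy.
  have e₁ : ω true 0 1 0 + ω true 0 1 1 + ω true 1 2 1 + ω true 1 2 2 + ω true 0 2 0 +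
    ω true 0 2 2 = 1 := by decide
  have e₂ : ω false 0 1 0 + ω false 0 1 1 + ω false 1 2 1 + ω false 1 2 2 + ω false 0 2 0 +
    ω false 0 2 2 = 0 := by decide
  -- In the sum of the three relations each `u i` and `u' i` occurs twice and vanishes modulo 2.
  have : (1 : ZMod 2) = 0 := by grind
  exact absurd this (by decide)
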